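/- Graphs are finite and simple (no loops, no multiple edges; possibly disconnected or empty), and a homomorphism $T\to G$ of graphs is a map $V(T)\to V(G)$ that sends adjacent vertices to adjacent vertices. Let $\mathrm{FI}$ be the category with objects $[n]=\{1,\dots,n\}$, $n\ge 0$, and injections as morphisms. An FI-graph $G_\bullet$ is a functor from $\mathrm{FI}$ to the category of graphs and graph homomorphisms; write $G_n=G([n])$. For $d\ge 0$, it is vertex-stable of stable degree $\le d$ if for all $n\ge d$ and every vertex $v\in V(G_{n+1})$ there are a vertex $w\in V(G_n)$ and an injection $f:[n]\hookrightarrow[n+1]$ with $G(f)(w)=v$. Let $T$ be any graph. (1) For every FI-graph $G_\bullet$ that is vertex-stable of stable degree $\le d$, there is a polynomial $p\in\mathbb{Q}[x]$ of degree $\le d\cdot|V(T)|$ such that the number of graph homomorphisms $T\to G_n$ equals $p(n)$ for all sufficiently large $n$. (2) The complete graphs $K_n$ on the vertex sets $[n]$, with each injection $f$ acting on vertices as $f$ itself, form an FI-graph $K_\bullet$ that is vertex-stable of stable degree $\le 1$. For every $n\ge 0$, the number of homomorphisms $T\to K_n$ equals the number of proper colourings of the vertices of $T$ with $n$ colours,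 i.e. of maps $c:V(T)\to[n]$ with $c(x)\ne c(y)$ whenever $x$ and $y$ are adjacent. Hence there is a polynomial in $\mathbb{Q}[x]$ of degree $\le|V(T)|$ that equals this number at $n$ for all sufficiently large $n$ (the chromatic polynomial of $T$). -/

import Mathlib

universe u v

/-- An FI-graph: a functor from the category FI, whose objects are the sets `[n]` (here `Fin n`,
for `n : ℕ`) and whose morphisms are the injections, to the category of finite simple graphs and
graph homomorphisms.  `G.graph n` is the graph `G_n` (with vertex set `G.V n`) and `G.map f` is
the transition map induced by the injection `f`. -/
structure FIGraph where
  /-- The vertex set of `G_n`. -/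
  V : ℕ → Type u
  /-- All the graphs `G_n` are finite. -/
  finite_V : ∀ n, Finite (V n)
  /-- The graph `G_n`. -/
  graph : ∀ n, SimpleGraph (V n)
  /-- The transition maps. -/
  map : ∀ {m n : ℕ}, (Fin m ↪ Fin n) → (graph m →g graph n)
  /-- Functoriality: identities. -/
  map_id : ∀ n, map (Function.Embedding.refl (Fin n)) = SimpleGraph.Hom.id
  /-- Functoriality: compositions (`f.trans g` is first `f`, then `g`). -/
  map_comp : ∀ {l m n : ℕ} (f : Fin l ↪ Fin m) (g : Fin m ↪ Fin n),
    map (f.trans g) = (map g).comp (map f)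

/-- `G` is vertex-stable with stable degree `≤ d`: for all `n ≥ d`, every vertex of `G_{n+1}` is
the image of a vertex of `G_n` under the transition map of some injection `[n] ↪ [n+1]`. -/
def FIGraph.IsVertexStable (G : FIGraph.{u}) (d : ℕ) : Prop :=
  ∀ n, d ≤ n → ∀ v : G.V (n + 1), ∃ (w : G.V n) (f : Fin n ↪ Fin (n + 1)), G.map f w = v

/-- The FI-graph `K_•` of complete graphs: `K_n` is the complete graph on `[n]`, and the transition
map of an injection `f` is `f` itself on vertices. -/
def FIGraph.complete : FIGraph.{0} where
  V n := Fin n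
  finite_V _ := inferInstance
  graph n := (⊤ : SimpleGraph (Fin n))
  map f := ⟨f, fun {_ _} h => f.injective.ne h⟩
  map_id _ := rfl
  map_comp _ _ := rfl

/-! For `n ≥ d` every vertex of `G_n` is the image of some `w ∈ G_d` under an injection `[d] ↪ [n]`,
so homomorphisms can be counted through tuples of such presentations, each weighted by the inverse
sizes of its fibres (`card_subtype_eq_sum_fiber`). By symmetry a fibre size depends only on `w` and
`n`. Tuples of injections satisfying a condition preserved by postcomposition are eventually
polynomial in number: the condition depends only on the coincidence pattern and `n`, is monotone in
`n`, and each pattern contributes a falling factorial (`exists_polynomial_card_functions`). The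
count is thus eventually a rational function of `n`. Being integral, it is eventually a polynomial,
and the bound `(|G_d| n ^ d) ^ |T|` controls its degree. -/

open Polynomial Filter

/-! ### Functions into `[n]` up to injections -/

/-- Two finite families of points with the same coincidences differ by an injection. -/
theorem exists_embedding_comp_eq {A : Type*} {m n : ℕ} (hmn : m ≤ n) (x : A → Fin m)
    (y : A → Fin n) (h : ∀ a b, x a = x b ↔ y a = y b) :
    ∃ e : Fin m ↪ Fin n, ∀ a, e (x a) = y a := by
  classical
  -- The values off the range of `x` are placeholders; only the restriction of `f` to that range is
  -- extended to an injection.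
  let f : Fin m → Fin n := fun i => if hi : ∃ a, x a = i then y hi.choose else Fin.castLE hmn i
  have hf : ∀ a, f (x a) = y a := by
    intro a
    have hi : ∃ b, x b = x a := ⟨a, rfl⟩
    simp only [f, dif_pos hi]
    exact (h _ _).1 hi.choose_spec
  let s : Finset (Fin m) := Finset.univ.filter (fun i => ∃ a, x a = i)
  have hinj : Set.InjOn f s := by
    intro i hi j hj hij
    simp only [s, Finset.coe_filter, Finset.mem_univ, true_and, Set.mem_ofPred_eq] at hi hj
    obtain ⟨a, rfl⟩ := hi
    obtain ⟨b, rfl⟩ := hj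
    rw [hf, hf] at hij
    exact (h _ _).2 hij
  have hcard : (s.image f).card ≤ m :=
    Finset.card_image_le.trans ((Finset.card_le_univ _).trans (by simp))
  obtain ⟨t, ht, htm⟩ := Finset.exists_superset_card_eq hcard (by simpa using hmn)
  obtain ⟨g, hg⟩ := Finset.exists_equiv_extend_of_card_eq (α := Fin m) (t := t)
    (by simp [htm]) ht hinj
  refine ⟨g.toEmbedding.trans (Function.Embedding.subtype _), fun a => ?_⟩
  rw [← hf a]
  exact hg _ (by simp [s])

/-- The functions with a prescribed kernel are the injections of the quotient. -/
theorem card_ker_eq {A : Type*} [Finite A] (s : Setoid A) (n : ℕ) :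
    Nat.card {y : A → Fin n // Setoid.ker y = s} = n.descFactorial (Nat.card (Quotient s)) := by
  classical
  have := Fintype.ofFinite (Quotient s)
  let e : {y : A → Fin n // Setoid.ker y = s} ≃ (Quotient s ↪ Fin n) :=
    { toFun := fun y => ⟨Quotient.lift y.1 (fun a b hab => by
          have : (Setoid.ker y.1) a b := by rw [y.2]; exact hab
          exact this), by
        intro a b
        induction a using Quotient.inductionOn
        induction b using Quotient.inductionOn
        intro hab
        refine Quotient.sound ?_
        rename_i a b
        have : (Setoid.ker y.1) a b := hab
        rw [y.2] at this
        exact this⟩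
      invFun := fun f => ⟨fun a => f (Quotient.mk s a), by
        ext a b
        simp only [Setoid.ker_def, f.injective.eq_iff]
        exact Quotient.eq⟩
      left_inv := fun y => rfl
      right_inv := fun f => by
        ext a
        induction a using Quotient.inductionOn
        rfl }
  rw [Nat.card_congr e, Nat.card_eq_fintype_card, Fintype.card_embedding_eq, Fintype.card_fin,
    Nat.card_eq_fintype_card]

/-- A family of sets of functions `A → Fin n`, closed under postcomposition with injections, has
eventually polynomial cardinality. -/
theorem exists_polynomial_card_functions {A : Type*} [Finite A]
    (P : ∀ n : ℕ, (A → Fin n) → Prop)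
    (hP : ∀ {m n : ℕ} (h : Fin m ↪ Fin n) (x : A → Fin m), P m x → P n (h ∘ x)) :
    ∃ p : ℚ[X], ∀ᶠ n : ℕ in atTop, (Nat.card {x // P n x} : ℚ) = p.eval (n : ℚ) := by
  classical
  have : Finite (Setoid A) :=
    Finite.of_injective (fun s : Setoid A => s.r) (fun s t h => Setoid.ext fun a b => by
      have := congrFun (congrFun h a) b
      exact iff_of_eq this)
  have := Fintype.ofFinite (Setoid A)
  let R : Setoid A → ℕ → Prop := fun s n => ∃ x : A → Fin n, Setoid.ker x = s ∧ P n x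
  have hPR : ∀ n (y : A → Fin n), P n y ↔ R (Setoid.ker y) n := by
    refine fun n y => ⟨fun h => ⟨y, rfl, h⟩, fun ⟨x, hx, h⟩ => ?_⟩
    -- Functions into `[n]` with the same kernel differ by a permutation of `[n]`, so one witness
    -- decides for all.
    obtain ⟨e, he⟩ := exists_embedding_comp_eq le_rfl x y (fun a b => by
      rw [← Setoid.ker_def, hx, Setoid.ker_def])
    have : y = e ∘ x := funext fun a => (he a).symm
    rw [this]
    exact hP e x h
  have hmono : ∀ s m n, m ≤ n → R s m → R s n := by
    rintro s m n hmn ⟨x, hx, h⟩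
    refine ⟨Fin.castLEEmb hmn ∘ x, ?_, hP _ x h⟩
    rw [← hx]
    ext a b
    simp [Setoid.ker_def]
  have hstab : ∀ s, ∃ c : Prop, ∀ᶠ n in atTop, R s n ↔ c := by
    intro s
    by_cases h : ∃ m, R s m
    · obtain ⟨m, hm⟩ := h
      refine ⟨True, ?_⟩
      filter_upwards [eventually_ge_atTop m] with n hn
      simpa using hmono s m n hn hm
    · push Not at h
      exact ⟨False, Eventually.of_forall fun n => by simpa using h n⟩
  choose c hc using hstab
  refine ⟨∑ s : Setoid A, if c s then descPochhammer ℚ (Nat.card (Quotient s)) else 0, ?_⟩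
  filter_upwards [eventually_all.2 hc] with n hn
  let e : {x // P n x} ≃ Σ s : Setoid A, {y : A → Fin n // Setoid.ker y = s ∧ c s} :=
    { toFun := fun x => ⟨Setoid.ker x.1, x.1, rfl, (hn _).1 ((hPR n x.1).1 x.2)⟩
      invFun := fun y => ⟨y.2.1, (hPR n _).2 (by rw [y.2.2.1]; exact (hn _).2 y.2.2.2)⟩
      left_inv := fun x => rfl
      right_inv := by
        rintro ⟨s, y, rfl, h⟩
        rfl }
  rw [Nat.card_congr e, Nat.card_sigma, Nat.cast_sum, eval_finsetSum]
  refine Finset.sum_congr rfl fun s _ => ?_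
  by_cases h : c s
  · simp only [h, and_true, if_true]
    rw [card_ker_eq, descPochhammer_eval_eq_descFactorial]
  · simp [h]

/-! ### Eventually rational sequences -/

/-- A sequence that eventually agrees with a rational function. -/
def EventuallyRational (a : ℕ → ℚ) : Prop :=
  ∃ P Q : ℚ[X], Q ≠ 0 ∧ ∀ᶠ n : ℕ in atTop, a n = P.eval (n : ℚ) / Q.eval (n : ℚ)

theorem eventually_eval_natCast_ne_zero {Q : ℚ[X]} (hQ : Q ≠ 0) :
    ∀ᶠ n : ℕ in atTop, Q.eval (n : ℚ) ≠ 0 :=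
  tendsto_natCast_atTop_atTop.eventually (Q.eventually_atTop_not_isRoot hQ)

namespace EventuallyRational

theorem of_polynomial {a : ℕ → ℚ} (h : ∃ p : ℚ[X], ∀ᶠ n : ℕ in atTop, a n = p.eval (n : ℚ)) :
    EventuallyRational a := by
  obtain ⟨p, hp⟩ := h
  exact ⟨p, 1, one_ne_zero, by simpa using hp⟩

theorem congr {a b : ℕ → ℚ} (hb : EventuallyRational b) (h : ∀ᶠ n in atTop, a n = b n) :
    EventuallyRational a := by
  obtain ⟨P, Q, hQ, hPQ⟩ := hb
  exact ⟨P, Q, hQ, by filter_upwards [h, hPQ] with n h₁ h₂ using h₁.trans h₂⟩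

theorem const (c : ℚ) : EventuallyRational fun _ => c :=
  of_polynomial ⟨C c, by simp⟩

theorem add {a b : ℕ → ℚ} (ha : EventuallyRational a) (hb : EventuallyRational b) :
    EventuallyRational fun n => a n + b n := by
  obtain ⟨P, Q, hQ, h⟩ := ha
  obtain ⟨P', Q', hQ', h'⟩ := hb
  refine ⟨P * Q' + Q * P', Q * Q', mul_ne_zero hQ hQ', ?_⟩
  filter_upwards [h, h', eventually_eval_natCast_ne_zero hQ,
    eventually_eval_natCast_ne_zero hQ'] with n h₁ h₂ h₃ h₄
  rw [h₁, h₂, div_add_div _ _ h₃ h₄]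
  simp

theorem mul {a b : ℕ → ℚ} (ha : EventuallyRational a) (hb : EventuallyRational b) :
    EventuallyRational fun n => a n * b n := by
  obtain ⟨P, Q, hQ, h⟩ := ha
  obtain ⟨P', Q', hQ', h'⟩ := hb
  refine ⟨P * P', Q * Q', mul_ne_zero hQ hQ', ?_⟩
  filter_upwards [h, h'] with n h₁ h₂
  rw [h₁, h₂, div_mul_div_comm]
  simp

theorem inv {a : ℕ → ℚ} (ha : EventuallyRational a) : EventuallyRational fun n => (a n)⁻¹ := by
  obtain ⟨P, Q, hQ, h⟩ := ha
  by_cases hP : P = 0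
  · exact (const 0).congr (by filter_upwards [h] with n hn; simp [hn, hP])
  · exact ⟨Q, P, hP, by filter_upwards [h] with n hn; rw [hn, inv_div]⟩

theorem sum {ι : Type*} (s : Finset ι) {a : ι → ℕ → ℚ} (ha : ∀ i, EventuallyRational (a i)) :
    EventuallyRational fun n => ∑ i ∈ s, a i n := by
  classical
  induction s using Finset.induction_on with
  | empty => simpa using const 0
  | insert i s hi ih => simpa [Finset.sum_insert hi] using (ha i).add ih

theorem prod {ι : Type*} (s : Finset ι) {a : ι → ℕ → ℚ} (ha : ∀ i, EventuallyRational (a i)) :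
    EventuallyRational fun n => ∏ i ∈ s, a i n := by
  classical
  induction s using Finset.induction_on with
  | empty => simpa using const 1
  | insert i s hi ih => simpa [Finset.prod_insert hi] using (ha i).mul ih

end EventuallyRational

/-- A rational polynomial takes values with bounded denominator at the natural numbers. -/
theorem exists_nat_mul_eval_eq_int (A : ℚ[X]) :
    ∃ m : ℕ, m ≠ 0 ∧ ∀ n : ℕ, ∃ z : ℤ, (m : ℚ) * A.eval (n : ℚ) = z := by
  induction A using Polynomial.induction_on' with
  | add p q hp hq =>
    obtain ⟨k, hk, hk'⟩ := hp
    obtain ⟨l, hl, hl'⟩ := hq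
    refine ⟨k * l, mul_ne_zero hk hl, fun n => ?_⟩
    obtain ⟨y, hy⟩ := hk' n
    obtain ⟨z, hz⟩ := hl' n
    refine ⟨l * y + k * z, ?_⟩
    push_cast
    rw [eval_add, ← hy, ← hz]
    ring
  | monomial i a =>
    refine ⟨a.den, a.den_ne_zero, fun n => ⟨a.num * n ^ i, ?_⟩⟩
    rw [eval_monomial, ← mul_assoc, Rat.den_mul_eq_num]
    push_cast
    rfl

/-- An integer sequence that eventually agrees with a rational function eventually agrees with a
polynomial. -/
theorem EventuallyRational.exists_polynomial {a : ℕ → ℕ}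
    (ha : EventuallyRational fun n => (a n : ℚ)) :
    ∃ p : ℚ[X], ∀ᶠ n : ℕ in atTop, (a n : ℚ) = p.eval (n : ℚ) := by
  obtain ⟨P, Q, hQ, h⟩ := ha
  -- Here `m` clears the denominators of the polynomial part, so `m` times the remainder term is an
  -- integer tending to `0`, hence eventually `0`.
  obtain ⟨m, hm, hint⟩ := exists_nat_mul_eval_eq_int (P / Q)
  have hdiv : ∀ x : ℚ, Q.eval x ≠ 0 →
      P.eval x / Q.eval x = (P / Q).eval x + (P % Q).eval x / Q.eval x := by
    intro x hx
    conv_lhs => rw [← EuclideanDomain.div_add_mod P Q]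
    rw [eval_add, eval_mul, add_div, mul_div_cancel_left₀ _ hx]
  have hlim : Tendsto (fun n : ℕ => (m : ℚ) * ((P % Q).eval (n : ℚ) / Q.eval (n : ℚ))) atTop
      (nhds 0) := by
    have := (Polynomial.div_tendsto_atTop_zero_of_degree_lt (P % Q) Q
      (EuclideanDomain.mod_lt P hQ)).comp (tendsto_natCast_atTop_atTop (R := ℚ))
    simpa using this.const_mul (m : ℚ)
  refine ⟨P / Q, ?_⟩
  filter_upwards [h, eventually_eval_natCast_ne_zero hQ,
    hlim.abs.eventually_lt_const (show |(0 : ℚ)| < 1 by simp)] with n h₁ h₂ hlt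
  obtain ⟨z, hz⟩ := hint n
  rw [hdiv _ h₂] at h₁
  have hr : (m : ℚ) * ((P % Q).eval (n : ℚ) / Q.eval (n : ℚ)) = ((m * a n - z : ℤ) : ℚ) := by
    push_cast
    rw [← hz, h₁]
    ring
  rw [hr] at hlt
  have h0 : (m * a n - z : ℤ) = 0 := Int.abs_lt_one_iff.1 (by exact_mod_cast hlt)
  rw [h0] at hr
  have hm' : (m : ℚ) ≠ 0 := by exact_mod_cast hm
  have := (mul_eq_zero.1 (hr.trans Int.cast_zero)).resolve_left hm'
  rw [h₁, this, add_zero]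

/-- A polynomial bounded by `C * n ^ k` at the natural numbers has degree at most `k`. -/
theorem natDegree_le_of_eventually_le {p : ℚ[X]} {c : ℚ} {k : ℕ}
    (h : ∀ᶠ n : ℕ in atTop, |p.eval (n : ℚ)| ≤ c * (n : ℚ) ^ k) : p.natDegree ≤ k := by
  by_contra! hk
  have hp : p ≠ 0 := by rintro rfl; simp at hk
  have hdeg : (X ^ k : ℚ[X]).degree < p.degree := by
    rw [degree_X_pow, degree_eq_natDegree hp]
    exact_mod_cast hk
  have hlim := (Polynomial.abs_div_tendsto_atTop_atTop_of_degree_gt p (X ^ k) hdeg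
    (pow_ne_zero _ X_ne_zero)).comp (tendsto_natCast_atTop_atTop (R := ℚ))
  obtain ⟨n, h₁, h₂, h₃⟩ := (h.and ((hlim.eventually_gt_atTop c).and
    (eventually_gt_atTop 0))).exists
  have hn : (0 : ℚ) < (n : ℚ) ^ k := by positivity
  simp only [Function.comp_apply, eval_pow, eval_X, abs_div, abs_of_pos hn] at h₂
  rw [lt_div_iff₀ hn] at h₂
  exact absurd h₁ (not_le.2 h₂)

/-! ### Counting tuples of injections and weighted representatives -/

/-- A family of sets of tuples of injections (with a label from a finite set), closed under
postcomposition, has eventually polynomial cardinality. -/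
theorem eventuallyRational_card_embeddings {K I : Type*} [Finite K] [Finite I] (d : ℕ)
    (Q : ∀ n : ℕ, K → (I → (Fin d ↪ Fin n)) → Prop)
    (hQ : ∀ {m n : ℕ} (h : Fin m ↪ Fin n) (k : K) (F : I → (Fin d ↪ Fin m)),
      Q m k F → Q n k fun i => (F i).trans h) :
    EventuallyRational fun n =>
      (Nat.card {q : K × (I → (Fin d ↪ Fin n)) // Q n q.1 q.2} : ℚ) := by
  have := Fintype.ofFinite K
  have hk : ∀ k : K, EventuallyRational fun n => (Nat.card {F // Q n k F} : ℚ) := by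
    intro k
    let P : ∀ n : ℕ, (I × Fin d → Fin n) → Prop := fun n x =>
      ∃ F : I → (Fin d ↪ Fin n), (∀ i a, F i a = x (i, a)) ∧ Q n k F
    have hP : ∀ {m n : ℕ} (h : Fin m ↪ Fin n) (x : I × Fin d → Fin m), P m x → P n (h ∘ x) := by
      rintro m n h x ⟨F, hF, hF'⟩
      exact ⟨fun i => (F i).trans h, fun i a => by simp [hF], hQ h k F hF'⟩
    refine (EventuallyRational.of_polynomial (exists_polynomial_card_functions P hP)).congr
      (Eventually.of_forall fun n => ?_)
    congr 1
    refine Nat.card_congr (Equiv.ofBijective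
      (fun F => ⟨fun q => F.1 q.1 q.2, F.1, fun _ _ => rfl, F.2⟩) ⟨?_, ?_⟩)
    · intro F F' h
      ext i a
      exact congrArg Fin.val (congrFun (congrArg Subtype.val h) (i, a))
    · rintro ⟨x, F, hF, hF'⟩
      exact ⟨⟨F, hF'⟩, Subtype.ext (funext fun q => hF q.1 q.2)⟩
  refine (EventuallyRational.sum Finset.univ hk).congr (Eventually.of_forall fun n => ?_)
  rw [← Nat.cast_sum, ← Nat.card_sigma]
  congr 1
  exact Nat.card_congr
    { toFun := fun q => ⟨q.1.1, q.1.2, q.2⟩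
      invFun := fun q => ⟨(q.1, q.2.1), q.2.2⟩
      left_inv := fun _ => rfl
      right_inv := fun _ => rfl }

/-- Counting tuples in a quotient by weighting the tuples of representatives. -/
theorem card_subtype_eq_sum_fiber {E V W : Type*} [Fintype E] [Finite V] [Fintype W]
    [DecidableEq W]
    (ev : E → V) (hev : Function.Surjective ev) (P : (W → V) → Prop) [DecidablePred P] :
    (Nat.card {φ // P φ} : ℚ) = ∑ e : W → E,
      if P (ev ∘ e) then ∏ i, (Nat.card {e' // ev e' = ev (e i)} : ℚ)⁻¹ else 0 := by
  classical
  have := Fintype.ofFinite V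
  -- The lifts of `φ` form a product of fibres, so their weights add up to `1`.
  have hfib : ∀ φ : W → V, (Nat.card {e : W → E // ev ∘ e = φ} : ℚ) *
      ∏ i, (Nat.card {e' // ev e' = φ i} : ℚ)⁻¹ = 1 := by
    intro φ
    have hc : Nat.card {e : W → E // ev ∘ e = φ} = ∏ i, Nat.card {e' // ev e' = φ i} := by
      rw [← Nat.card_pi]
      exact Nat.card_congr
        ((Equiv.subtypeEquivRight fun e => by rw [funext_iff]; rfl).trans
          (Equiv.subtypePiEquivPi (p := fun i e' => ev e' = φ i)))
    rw [hc, Nat.cast_prod, ← Finset.prod_mul_distrib]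
    refine Finset.prod_eq_one fun i _ => mul_inv_cancel₀ ?_
    obtain ⟨e', he'⟩ := hev (φ i)
    have : Nonempty {e' // ev e' = φ i} := ⟨⟨e', he'⟩⟩
    exact_mod_cast Nat.card_pos.ne'
  rw [← Fintype.sum_fiberwise (fun e : W → E => ev ∘ e)]
  have : ∀ φ : W → V, (∑ e : {e : W → E // ev ∘ e = φ},
      if P (ev ∘ e.1) then ∏ i, (Nat.card {e' // ev e' = ev (e.1 i)} : ℚ)⁻¹ else 0) =
      if P φ then 1 else 0 := by
    intro φ
    have h : ∀ e : {e : W → E // ev ∘ e = φ},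
        (if P (ev ∘ e.1) then ∏ i, (Nat.card {e' // ev e' = ev (e.1 i)} : ℚ)⁻¹ else 0) =
        if P φ then ∏ i, (Nat.card {e' // ev e' = φ i} : ℚ)⁻¹ else 0 := by
      rintro ⟨e, rfl⟩
      rfl
    rw [Finset.sum_congr rfl fun e _ => h e, Finset.sum_const, Finset.card_univ, nsmul_eq_mul,
      ← Nat.card_eq_fintype_card, mul_ite, hfib, mul_zero]
  rw [Finset.sum_congr rfl fun φ _ => this φ, Finset.sum_boole, Nat.card_eq_fintype_card,
    Fintype.card_subtype]

/-! ### Presentations of vertices -/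

namespace FIGraph

variable (G : FIGraph.{u})

theorem map_trans_apply {l m n : ℕ} (f : Fin l ↪ Fin m) (g : Fin m ↪ Fin n) (v : G.V l) :
    G.map (f.trans g) v = G.map g (G.map f v) := by
  rw [G.map_comp]
  rfl

theorem map_refl_apply {n : ℕ} (v : G.V n) : G.map (Function.Embedding.refl (Fin n)) v = v := by
  rw [G.map_id]
  rfl

variable {G}

theorem IsVertexStable.exists_map_eq {d : ℕ} (hG : G.IsVertexStable d) {n : ℕ} (hn : d ≤ n)
    (v : G.V n) : ∃ (w : G.V d) (f : Fin d ↪ Fin n), G.map f w = v := by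
  induction n, hn using Nat.le_induction with
  | base => exact ⟨v, _, G.map_refl_apply v⟩
  | succ n hn ih =>
    obtain ⟨w, f, rfl⟩ := hG n hn v
    obtain ⟨w', g, rfl⟩ := ih w
    exact ⟨w', g.trans f, G.map_trans_apply g f w'⟩

variable (G)

/-- The ways of writing the vertex `v` as the image of a vertex of `G_d`. -/
abbrev Presentation (d : ℕ) {n : ℕ} (v : G.V n) : Type u :=
  {q : G.V d × (Fin d ↪ Fin n) // G.map q.2 q.1 = v}

instance (n : ℕ) : Finite (G.V n) := G.finite_V n

theorem card_presentation_map (d : ℕ) {n : ℕ} (v : G.V n) (e : Fin n ≃ Fin n) :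
    Nat.card (G.Presentation d (G.map e.toEmbedding v)) = Nat.card (G.Presentation d v) := by
  have hinv : ∀ (e : Fin n ≃ Fin n) (x : G.V n),
      G.map e.symm.toEmbedding (G.map e.toEmbedding x) = x := by
    intro e x
    rw [← G.map_trans_apply]
    convert G.map_refl_apply x
    ext a
    simp
  refine (Nat.card_congr (Equiv.subtypeEquiv (Equiv.prodCongr (Equiv.refl _)
    (Equiv.embeddingCongr (Equiv.refl _) e)) fun q => ?_)).symm
  have : G.map (Equiv.embeddingCongr (Equiv.refl _) e q.2) q.1 =
      G.map e.toEmbedding (G.map q.2 q.1) := by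
    rw [← G.map_trans_apply]
    rfl
  simp only [Equiv.prodCongr_apply, Prod.map_fst, Prod.map_snd, Equiv.refl_apply, this]
  exact ⟨fun h => by rw [h], fun h => by rw [← hinv e (G.map q.2 q.1), h, hinv]⟩

/-- Any two injections `[d] ↪ [n]` differ by a permutation of `[n]`, which acts bijectively on
presentations. -/
theorem card_presentation_eq (d : ℕ) {n : ℕ} (w : G.V d) (f g : Fin d ↪ Fin n) :
    Nat.card (G.Presentation d (G.map f w)) = Nat.card (G.Presentation d (G.map g w)) := by
  obtain ⟨e, he⟩ := exists_embedding_comp_eq le_rfl g f (fun a b => by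
    rw [f.injective.eq_iff, g.injective.eq_iff])
  have hf : f = g.trans e := Function.Embedding.ext fun a => (he a).symm
  have := G.card_presentation_map d (G.map g w)
    (Equiv.ofBijective e (Finite.injective_iff_bijective.1 e.injective))
  rw [← this, hf, G.map_trans_apply]
  rfl

/-- The average number of presentations of an image in `G_n` of the vertex `w` of `G_d`. -/
noncomputable def fiberCard {d : ℕ} (w : G.V d) (n : ℕ) : ℚ :=
  (Nat.card {q : G.V d × (Fin 2 → (Fin d ↪ Fin n)) // G.map (q.2 1) q.1 = G.map (q.2 0) w} : ℚ) *
    (Nat.card (Fin d ↪ Fin n) : ℚ)⁻¹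

/-- The averaged quantities are all equal, so the average is each of them; averaging makes the fibre
size a quotient of two counts of tuples of injections. -/
theorem fiberCard_eq {d : ℕ} (w : G.V d) {n : ℕ} (f : Fin d ↪ Fin n) :
    G.fiberCard w n = Nat.card (G.Presentation d (G.map f w)) := by
  classical
  let e : {q : G.V d × (Fin 2 → (Fin d ↪ Fin n)) // G.map (q.2 1) q.1 = G.map (q.2 0) w} ≃
      Σ g : Fin d ↪ Fin n, G.Presentation d (G.map g w) :=
    { toFun := fun q => ⟨q.1.2 0, (q.1.1, q.1.2 1), q.2⟩
      invFun := fun q => ⟨(q.2.1.1, ![q.1, q.2.1.2]), q.2.2⟩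
      left_inv := fun q => by
        refine Subtype.ext (Prod.ext rfl (funext fun i => ?_))
        fin_cases i <;> rfl
      right_inv := fun _ => rfl }
  have hpos : (Nat.card (Fin d ↪ Fin n) : ℚ) ≠ 0 := by
    have : Nonempty (Fin d ↪ Fin n) := ⟨f⟩
    exact_mod_cast Nat.card_pos.ne'
  rw [fiberCard, Nat.card_congr e, Nat.card_sigma,
    Finset.sum_congr rfl fun g _ => G.card_presentation_eq d w g f, Finset.sum_const,
    Finset.card_univ, ← Nat.card_eq_fintype_card, smul_eq_mul, Nat.cast_mul]
  field_simp

theorem eventuallyRational_fiberCard {d : ℕ} (w : G.V d) :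
    EventuallyRational (G.fiberCard w) := by
  refine EventuallyRational.mul ?_ (EventuallyRational.inv ?_)
  · refine eventuallyRational_card_embeddings (K := G.V d) (I := Fin 2) d
      (fun n k F => G.map (F 1) k = G.map (F 0) w) ?_
    intro m n h k F hF
    simp only [G.map_trans_apply, hF]
  · refine (eventuallyRational_card_embeddings (K := Unit) (I := Unit) d
      (fun _ _ _ => True) (fun _ _ _ _ => trivial)).congr (Eventually.of_forall fun n => ?_)
    simp

end FIGraph

/-! ### Counting homomorphisms -/

/-- Homomorphisms of graphs as a subtype of the maps between the vertex sets. -/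
def SimpleGraph.homEquivSubtype {W : Type*} {V : Type*} (T : SimpleGraph W) (H : SimpleGraph V) :
    (T →g H) ≃ {φ : W → V // ∀ x y, T.Adj x y → H.Adj (φ x) (φ y)} where
  toFun φ := ⟨φ, fun _ _ h => φ.map_adj h⟩
  invFun φ := ⟨φ.1, fun {_ _} h => φ.2 _ _ h⟩
  left_inv _ := rfl
  right_inv _ := rfl

namespace FIGraph

variable {G : FIGraph.{u}}

theorem IsVertexStable.surjective {d : ℕ} (hG : G.IsVertexStable d) {n : ℕ} (hn : d ≤ n) :
    Function.Surjective fun q : G.V d × (Fin d ↪ Fin n) => G.map q.2 q.1 := fun v => by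
  obtain ⟨w, f, h⟩ := hG.exists_map_eq hn v
  exact ⟨(w, f), h⟩

theorem IsVertexStable.eventuallyRational_card_hom {W : Type v} [Fintype W] (T : SimpleGraph W)
    {d : ℕ} (hG : G.IsVertexStable d) :
    EventuallyRational fun n => (Nat.card (T →g G.graph n) : ℚ) := by
  classical
  have := Fintype.ofFinite (G.V d)
  let P : ∀ n, (W → G.V n) → Prop := fun n φ =>
    ∀ x y, T.Adj x y → (G.graph n).Adj (φ x) (φ y)
  have hnum : ∀ w : W → G.V d, EventuallyRational fun n =>
      (Nat.card {F : W → (Fin d ↪ Fin n) // P n fun i => G.map (F i) (w i)} : ℚ) := by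
    intro w
    refine (eventuallyRational_card_embeddings (K := Unit) (I := W) d
      (fun n _ F => P n fun i => G.map (F i) (w i)) ?_).congr (Eventually.of_forall fun n => ?_)
    · intro m n h _ F hF x y hxy
      simp only [G.map_trans_apply]
      -- Transition maps preserve adjacency but need not reflect it; closure in this one direction
      -- suffices.
      exact (G.map h).map_adj (hF x y hxy)
    · congr 1
      exact Nat.card_congr
        { toFun := fun F => ⟨((), F.1), F.2⟩
          invFun := fun F => ⟨F.1.2, F.2⟩
          left_inv := fun _ => rfl
          right_inv := fun _ => rfl }
  refine (EventuallyRational.sum Finset.univ fun w : W → G.V d => (hnum w).mul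
    (EventuallyRational.prod Finset.univ fun i =>
      (G.eventuallyRational_fiberCard (w i)).inv)).congr ?_
  filter_upwards [eventually_ge_atTop d] with n hn
  rw [Nat.card_congr (SimpleGraph.homEquivSubtype T (G.graph n)),
    card_subtype_eq_sum_fiber _ (hG.surjective hn) (P n),
    -- Splitting a tuple of presentations into vertices `w` and injections `F` makes the weight
    -- independent of `F`.
    ← (Equiv.arrowProdEquivProdArrow W (fun _ => G.V d) (fun _ => Fin d ↪ Fin n)).symm.sum_comp,
    Fintype.sum_prod_type]
  refine Finset.sum_congr rfl fun w _ => ?_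
  rw [Nat.card_eq_fintype_card, Fintype.card_subtype, ← nsmul_eq_mul, ← Finset.sum_const,
    Finset.sum_filter]
  refine Finset.sum_congr rfl fun F _ => ?_
  refine if_congr Iff.rfl (Finset.prod_congr rfl fun i _ => ?_) rfl
  rw [G.fiberCard_eq (w i) (F i)]
  rfl

theorem IsVertexStable.exists_polynomial_card_hom {W : Type v} [Fintype W] (T : SimpleGraph W)
    {d : ℕ} (hG : G.IsVertexStable d) :
    ∃ p : ℚ[X], p.natDegree ≤ d * Fintype.card W ∧
      ∀ᶠ n : ℕ in atTop, (Nat.card (T →g G.graph n) : ℚ) = p.eval (n : ℚ) := by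
  obtain ⟨p, hp⟩ := (hG.eventuallyRational_card_hom T).exists_polynomial
  refine ⟨p, natDegree_le_of_eventually_le (c := (Nat.card (G.V d) : ℚ) ^ Fintype.card W) ?_, hp⟩
  filter_upwards [hp, eventually_ge_atTop d] with n h hn
  rw [← h, Nat.abs_cast, pow_mul, ← mul_pow]
  have h₁ : Nat.card (G.V n) ≤ Nat.card (G.V d) * n ^ d := by
    refine (Nat.card_le_card_of_surjective _ (hG.surjective hn)).trans ?_
    rw [Nat.card_prod]
    refine Nat.mul_le_mul_left _ ?_
    rw [Nat.card_eq_fintype_card, Fintype.card_embedding_eq]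
    simpa using Nat.descFactorial_le_pow n d
  have h₂ : Nat.card (T →g G.graph n) ≤ Nat.card (G.V n) ^ Fintype.card W := by
    refine (Nat.card_le_card_of_injective _ (DFunLike.coe_injective (F := T →g G.graph n))).trans ?_
    rw [Nat.card_fun, Nat.card_eq_fintype_card (α := W)]
  exact_mod_cast h₂.trans (Nat.pow_le_pow_left h₁ _)

theorem isVertexStable_complete : FIGraph.complete.IsVertexStable 1 := by
  intro n hn v
  change Fin (n + 1) at v
  -- The vertex `0` exists because `n ≥ 1`; the swap carries its image `0` to `v`.
  exact ⟨(⟨0, hn⟩ : Fin n), Fin.castSuccEmb.trans (Equiv.swap 0 v).toEmbedding,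
    Equiv.swap_apply_left 0 v⟩

theorem card_hom_complete {W : Type v} (T : SimpleGraph W) (n : ℕ) :
    Nat.card (T →g FIGraph.complete.graph n) =
      Nat.card {c : W → Fin n // ∀ x y, T.Adj x y → c x ≠ c y} :=
  Nat.card_congr (SimpleGraph.homEquivSubtype T (FIGraph.complete.graph n))

end FIGraph

theorem mainTheorem6 {W : Type v} [Fintype W] (T : SimpleGraph W) :
    -- the number of homomorphisms from `T` to `G_n` is eventually polynomial in `n`
    (∀ (G : FIGraph.{u}) (d : ℕ), G.IsVertexStable d →
      ∃ p : Polynomial ℚ, p.natDegree ≤ d * Fintype.card W ∧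
        ∀ᶠ n : ℕ in Filter.atTop, (Nat.card (T →g G.graph n) : ℚ) = p.eval (n : ℚ)) ∧
    -- the case `G = K_•`: homomorphisms to `K_n` are counted by proper `n`-colourings of `T`,
    -- whose number is therefore eventually polynomial in `n`
    (FIGraph.complete.IsVertexStable 1 ∧
      (∀ n : ℕ, Nat.card (T →g FIGraph.complete.graph n) =
        Nat.card {c : W → Fin n // ∀ x y, T.Adj x y → c x ≠ c y}) ∧
      ∃ p : Polynomial ℚ, p.natDegree ≤ Fintype.card W ∧
        ∀ᶠ n : ℕ in Filter.atTop,
          (Nat.card {c : W → Fin n // ∀ x y, T.Adj x y → c x ≠ c y} : ℚ) =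
            p.eval (n : ℚ)) := by
  refine ⟨fun G d hG => hG.exists_polynomial_card_hom T, FIGraph.isVertexStable_complete,
    FIGraph.card_hom_complete T, ?_⟩
  obtain ⟨p, hp, h⟩ := FIGraph.isVertexStable_complete.exists_polynomial_card_hom T
  exact ⟨p, by simpa using hp, by simpa only [FIGraph.card_hom_complete] using h⟩
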